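/- Let $n \ge 0$ and let $S_n$ be the group of permutations of $[n]=\{1,\dots,n\}$, with adjacent transpositions $s_i=(i\ \,i{+}1)$ for $1\le i\le n-1$. Let $\mathsf{TL}_n(2)$ be the Temperley--Lieb algebra, i.e. the unital associative $\mathbb{C}$-algebra with generators $e_1,\dots,e_{n-1}$ and relations $e_i^2=2e_i$; $e_ie_j=e_je_i$ if $|i-j|>1$; and $e_ie_je_i=e_i$ if $|i-j|=1$ (for $1\le i,j\le n-1$). A noncrossing partition of size $n$ is a set $\lambda$ of arcs $(i,j)$ with $1\le i<j\le n$ that contains no two distinct arcs $(i,k)$, $(j,l)$ with $i\le j<k\le l$. Let $\lambda^+$ be the set of left endpoints $i$ and $\lambda^-$ the set of right endpoints $j$ of the arcs $(i,j)\in\lambda$. For $w\in S_n$ put $E_{pos}(w)=\{i : i\le w_i\}$ and $E_{val}(w)=\{w_i : i\le w_i\}$, and define the excedance class of $\lambda$ to be $$\mathcal{C}_\lambda=\{w\in S_n : E_{val}(w)=[n]\setminus\lambda^+ \text{ and } E_{pos}(w)=[n]\setminus\lambda^-\}.$$ There is a unique $\mathbb{C}$-algebra homomorphism $\phi:\mathbb{C}S_n\to\mathsf{TL}_n(2)$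 with $\phi(s_i)=1-e_i$ for $1\le i\le n-1$, and it is surjective. Moreover, if for each noncrossing partition $\lambda$ of size $n$ an element $w_\lambda\in\mathcal{C}_\lambda$ is fixed, then the elements $\phi(w_\lambda)$, indexed by the noncrossing partitions $\lambda$ of size $n$, form a basis of $\mathsf{TL}_n(2)$ as a complex vector space. -/

import Mathlib

namespace TemperleyLieb

/-- The defining relations of the Temperley-Lieb algebra at loop parameter `2`.  The generators
`e_1, ..., e_{n-1}` are indexed by `Fin (n - 1)`, the index `i` standing for `e_{i+1}`. -/
inductive Rel (n : ℕ) :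
    FreeAlgebra ℂ (Fin (n - 1)) → FreeAlgebra ℂ (Fin (n - 1)) → Prop
  | sq (i : Fin (n - 1)) :
      Rel n (FreeAlgebra.ι ℂ i * FreeAlgebra.ι ℂ i) ((2 : ℂ) • FreeAlgebra.ι ℂ i)
  | comm (i j : Fin (n - 1)) (h : (i : ℕ) + 1 < j ∨ (j : ℕ) + 1 < i) :
      Rel n (FreeAlgebra.ι ℂ i * FreeAlgebra.ι ℂ j) (FreeAlgebra.ι ℂ j * FreeAlgebra.ι ℂ i)
  | braid (i j : Fin (n - 1)) (h : (i : ℕ) + 1 = j ∨ (j : ℕ) + 1 = i) :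
      Rel n (FreeAlgebra.ι ℂ i * FreeAlgebra.ι ℂ j * FreeAlgebra.ι ℂ i) (FreeAlgebra.ι ℂ i)

/-- The Temperley-Lieb algebra `TL_n(2)` over `ℂ`, by generators and relations. -/
abbrev TL (n : ℕ) : Type := RingQuot (Rel n)

/-- The generators of `TL_n(2)`. -/
noncomputable def e {n : ℕ} (i : Fin (n - 1)) : TL n :=
  RingQuot.mkAlgHom ℂ (Rel n) (FreeAlgebra.ι ℂ i)

/-- The adjacent transpositions of `S_n = Equiv.Perm (Fin n)`. -/
def s {n : ℕ} (i : Fin (n - 1)) : Equiv.Perm (Fin n) :=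
  Equiv.swap ⟨(i : ℕ), by omega⟩ ⟨(i : ℕ) + 1, by omega⟩

/-- A noncrossing partition of size `n`, given by its arcs `(i, j)`, `i < j`: no two distinct
arcs `(i, k)`, `(j, l)` satisfy `i ≤ j < k ≤ l`. -/
structure NCP (n : ℕ) where
  arcs : Finset (Fin n × Fin n)
  lt_of_mem : ∀ a ∈ arcs, a.1 < a.2
  noncrossing : ∀ a ∈ arcs, ∀ b ∈ arcs, a ≠ b → ¬ (a.1 ≤ b.1 ∧ b.1 < a.2 ∧ a.2 ≤ b.2)

/-- The set of left endpoints of arcs. -/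
def NCP.left {n : ℕ} (p : NCP n) : Finset (Fin n) := p.arcs.image Prod.fst

/-- The set of right endpoints of arcs. -/
def NCP.right {n : ℕ} (p : NCP n) : Finset (Fin n) := p.arcs.image Prod.snd

/-- The positions of the weak excedances of `w`. -/
def excPos {n : ℕ} (w : Equiv.Perm (Fin n)) : Finset (Fin n) :=
  Finset.univ.filter fun i => i ≤ w i

/-- The values of the weak excedances of `w`. -/
def excVal {n : ℕ} (w : Equiv.Perm (Fin n)) : Finset (Fin n) :=
  (excPos w).image w

/-- The excedance class determined by a noncrossing partition. -/
def excClass {n : ℕ} (p : NCP n) : Set (Equiv.Perm (Fin n)) :=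
  {w | excVal w = p.leftᶜ ∧ excPos w = p.rightᶜ}

end TemperleyLieb

/-!
The assignment `s_i ↦ 1 - e_i` respects the Coxeter relations of `S_n`. These present `S_n` because
every product of generators can be brought to the form `y * (s_0 * ⋯ * s_{k-1})`, where `y` is a
product of `s_1, s_2, …` and `k` is the position of the letter `0`. The resulting homomorphism
kills the antisymmetrizers of all triples of letters, and conversely every homomorphism on `S_n`
that kills them factors through the Temperley-Lieb algebra.

*Independence.* `S_n` permutes the subsets of `[n]`. On linear combinations of subsets the
antisymmetrizers vanish, so the Temperley-Lieb algebra acts there too. An element of the excedance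
class of `p` maps the complement of `p.right` onto the complement of `p.left`, and it can do the
same for another noncrossing partition `q` only if above every point there are at most as many arcs
of `q` as of `p`. Hence the matrix of the corresponding coefficients is triangular.

*Spanning.* The antisymmetrizer rewrites a permutation containing a `321` pattern in terms of
lexicographically smaller ones, so the `321`-avoiding permutations span. Such a permutation is
increasing on its weak excedances and on the other positions, and is therefore determined by its
excedance sets. As every permutation lies in the excedance class of some noncrossing partition,
the dimension is at most the number of these.
-/

namespace TemperleyLieb

open Equiv

section Coxeter

variable {M N : Type*} [Monoid M] [Monoid N] {n : ℕ}

/-- The Coxeter relations of type `A_n`, those of the adjacent transpositions of `n + 1` letters. -/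
structure IsCoxeterTypeA (t : Fin n → M) : Prop where
  mul_self (i : Fin n) : t i * t i = 1
  comm {i j : Fin n} (h : (i : ℕ) + 1 < j) : t i * t j = t j * t i
  braid {i j : Fin n} (h : (i : ℕ) + 1 = j) : t i * t j * t i = t j * t i * t j

namespace IsCoxeterTypeA

theorem prodMk {t : Fin n → M} {u : Fin n → N} (ht : IsCoxeterTypeA t) (hu : IsCoxeterTypeA u) :
    IsCoxeterTypeA fun i => (t i, u i) where
  mul_self i := Prod.ext (ht.mul_self i) (hu.mul_self i)
  comm h := Prod.ext (ht.comm h) (hu.comm h)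
  braid h := Prod.ext (ht.braid h) (hu.braid h)

theorem comp_succ {t : Fin (n + 1) → M} (ht : IsCoxeterTypeA t) :
    IsCoxeterTypeA fun i : Fin n => t i.succ where
  mul_self i := ht.mul_self i.succ
  comm h := ht.comm (by simpa using h)
  braid h := ht.braid (by simpa using h)

theorem partialProd_mul_of_lt {t : Fin n → M} (ht : IsCoxeterTypeA t) {k : Fin (n + 1)} {i : Fin n}
    (h : (k : ℕ) < i) : Fin.partialProd t k * t i = t i * Fin.partialProd t k := by
  induction k using Fin.induction with
  | zero => simp only [Fin.partialProd_zero, one_mul, mul_one]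
  | succ k ih =>
    rw [Fin.val_succ] at h
    rw [Fin.partialProd_succ, mul_assoc, ht.comm h, ← mul_assoc,
      ih (by simpa using (Nat.lt_succ_self _).trans h), mul_assoc]

theorem partialProd_mul_of_succ_lt {t : Fin n → M} (ht : IsCoxeterTypeA t) {k : Fin (n + 1)}
    {i j : Fin n} (hij : (i : ℕ) + 1 = j) (h : (j : ℕ) < k) :
    Fin.partialProd t k * t i = t j * Fin.partialProd t k := by
  induction k using Fin.induction with
  | zero => exact absurd h (Nat.not_lt_zero _)
  | succ k ih =>
    obtain hjk | hjk := (Nat.lt_succ_iff.1 h).lt_or_eq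
    · rw [Fin.partialProd_succ, mul_assoc, ← ht.comm (hij ▸ hjk), ← mul_assoc, ih hjk, mul_assoc]
    · obtain rfl : j = k := Fin.ext hjk
      have hcast : j.castSucc = i.succ := Fin.ext hij.symm
      rw [Fin.partialProd_succ, hcast, Fin.partialProd_succ, mul_assoc, mul_assoc,
        ← mul_assoc (t i), ht.braid hij, ← mul_assoc, ← mul_assoc,
        ht.partialProd_mul_of_lt (hij ▸ Nat.lt_succ_self _), mul_assoc, mul_assoc, mul_assoc]

theorem partialProd_succ_mul {t : Fin n → M} (ht : IsCoxeterTypeA t) (i : Fin n) :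
    Fin.partialProd t i.succ * t i = Fin.partialProd t i.castSucc := by
  rw [Fin.partialProd_succ, mul_assoc, ht.mul_self, mul_one]

theorem exists_mul_partialProd {t : Fin (n + 1) → M} (ht : IsCoxeterTypeA t) {x : M}
    (hx : x ∈ Submonoid.closure (Set.range t)) :
    ∃ y ∈ Submonoid.closure (Set.range fun i : Fin n => t i.succ),
      ∃ k, x = y * Fin.partialProd t k := by
  induction hx using Submonoid.closure_induction_right with
  | one => exact ⟨1, one_mem _, 0, by rw [Fin.partialProd_zero, one_mul]⟩
  | mul_right x _ _ hi ih =>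
    obtain ⟨i, rfl⟩ := hi
    obtain ⟨y, hy, k, rfl⟩ := ih
    obtain hik | hik | hik | hik :
        (k : ℕ) < i ∨ k = i.castSucc ∨ k = i.succ ∨ (i : ℕ) + 1 < k := by
      simp only [Fin.ext_iff, Fin.val_castSucc, Fin.val_succ]; omega
    · obtain ⟨j, rfl⟩ := Fin.exists_succ_eq.2 (Fin.pos_iff_ne_zero.1 hik.pos)
      refine ⟨y * t j.succ, mul_mem hy (Submonoid.subset_closure ⟨j, rfl⟩), k, ?_⟩
      rw [mul_assoc, ht.partialProd_mul_of_lt hik, mul_assoc]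
    · exact ⟨y, hy, i.succ, by rw [Fin.partialProd_succ, hik, mul_assoc]⟩
    · exact ⟨y, hy, i.castSucc, by rw [hik, mul_assoc, ht.partialProd_succ_mul]⟩
    · obtain ⟨j, rfl⟩ : ∃ j : Fin n, i = j.castSucc := ⟨⟨i, by omega⟩, rfl⟩
      refine ⟨y * t j.succ, mul_mem hy (Submonoid.subset_closure ⟨j, rfl⟩), k, ?_⟩
      rw [mul_assoc, ht.partialProd_mul_of_succ_lt (j := j.succ) rfl hik, mul_assoc]

end IsCoxeterTypeA

theorem swap_braid {α : Type*} [DecidableEq α] {a b c : α} (hab : a ≠ b) (hac : a ≠ c)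
    (hbc : b ≠ c) : swap a b * swap b c * swap a b = swap b c * swap a b * swap b c := by
  rw [swap_mul_swap_mul_swap hab hac, swap_comm a b, swap_comm b c,
    swap_mul_swap_mul_swap hbc.symm hac.symm, swap_comm]

theorem isCoxeterTypeA_swap (n : ℕ) :
    IsCoxeterTypeA fun i : Fin n => swap i.castSucc i.succ where
  mul_self i := swap_mul_self _ _
  comm {i j} h := by
    refine (Perm.disjoint_swap_swap ?_).commute.eq
    simp only [List.nodup_cons, List.mem_cons, List.not_mem_nil, or_false, not_false_eq_true,
      List.nodup_nil, and_true, Fin.ext_iff, Fin.val_castSucc, Fin.val_succ]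
    omega
  braid {i j} h := by
    have hij : i.succ = j.castSucc := Fin.ext h
    simp only [hij]
    refine swap_braid ?_ ?_ j.castSucc_lt_succ.ne <;>
      simp only [ne_eq, Fin.ext_iff, Fin.val_castSucc, Fin.val_succ] <;> omega

theorem viaEmbeddingHom_swap {α β : Type*} [DecidableEq α] [DecidableEq β] (ι : α ↪ β) (a b : α) :
    Perm.viaEmbeddingHom ι (swap a b) = swap (ι a) (ι b) := by
  ext x
  rw [Perm.viaEmbeddingHom_apply]
  by_cases hx : x ∈ Set.range ι
  · obtain ⟨y, rfl⟩ := hx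
    rw [Perm.viaEmbedding_apply, ι.injective.swap_apply]
  · rw [Perm.viaEmbedding_apply_of_notMem _ _ _ hx, swap_apply_of_ne_of_ne] <;>
      exact ne_of_mem_of_not_mem (Set.mem_range_self _) hx |>.symm

/-- The submonoid generated by the pairs `(g i, t i)` is the graph of the homomorphism. -/
theorem exists_monoidHom_of_injOn_fst {ι : Type*} {g : ι → M} {t : ι → N}
    (hg : Submonoid.closure (Set.range g) = ⊤)
    (hinj : Set.InjOn Prod.fst (Submonoid.closure (Set.range fun i => (g i, t i)) : Set (M × N))) :
    ∃ f : M →* N, ∀ i, f (g i) = t i := by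
  set G := Submonoid.closure (Set.range fun i => (g i, t i)) with hG
  have hfst : G.map (MonoidHom.fst M N) = ⊤ := by
    rw [hG, MonoidHom.map_mclosure, ← Set.range_comp]
    exact hg
  obtain ⟨f, hf⟩ := Submonoid.exists_eq_mgraph (G := G)
    ⟨fun x y hxy => Subtype.ext (hinj x.2 y.2 hxy), fun w => by
      obtain ⟨x, hx, rfl⟩ := hfst.ge (Submonoid.mem_top w)
      exact ⟨⟨x, hx⟩, rfl⟩⟩
  refine ⟨f, fun i => ?_⟩
  have hmem : (g i, t i) ∈ f.mgraph := hf ▸ Submonoid.subset_closure ⟨i, rfl⟩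
  exact hmem

theorem IsCoxeterTypeA.injOn_fst {t : Fin (n + 1) → M} (ht : IsCoxeterTypeA t)
    {f : Perm (Fin (n + 1)) →* M} (hf : ∀ i : Fin n, f (swap i.castSucc i.succ) = t i.succ) :
    Set.InjOn Prod.fst (Submonoid.closure (Set.range fun i : Fin (n + 1) =>
      (swap i.castSucc i.succ, t i)) : Set (Perm (Fin (n + 2)) × M)) := by
  let shift := Perm.viaEmbeddingHom (Fin.succEmb (n + 1))
  have hshift_zero v : shift v 0 = 0 := Perm.viaEmbedding_apply_of_notMem _ _ _ (by simp)
  set u := fun i : Fin (n + 1) => (swap i.castSucc i.succ, t i)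
  have hu : IsCoxeterTypeA u := (isCoxeterTypeA_swap _).prodMk ht
  have hself k : (Fin.partialProd u k).1 k = 0 := by
    induction k using Fin.induction with
    | zero => rw [Fin.partialProd_zero, Prod.fst_one, Perm.one_apply]
    | succ k ih =>
      rw [Fin.partialProd_succ, Prod.fst_mul, Perm.mul_apply, swap_apply_right, ih]
  have hclosure_le : Submonoid.closure (Set.range fun i : Fin n => u i.succ) ≤
      MonoidHom.mrange (shift.prod f) := by
    rw [Submonoid.closure_le]
    rintro _ ⟨i, rfl⟩
    exact ⟨swap i.castSucc i.succ, Prod.ext (viaEmbeddingHom_swap _ _ _) (hf i)⟩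
  intro x hx y hy hxy
  obtain ⟨_, hv, k, rfl⟩ := hu.exists_mul_partialProd hx
  obtain ⟨_, hw, l, rfl⟩ := hu.exists_mul_partialProd hy
  obtain ⟨v, rfl⟩ := hclosure_le hv
  obtain ⟨w, rfl⟩ := hclosure_le hw
  replace hxy : shift v * (Fin.partialProd u k).1 = shift w * (Fin.partialProd u l).1 := hxy
  obtain rfl : k = l := by
    have hk := congrArg (fun σ : Perm (Fin (n + 2)) => σ k) hxy
    simp only [Perm.mul_apply, hself, hshift_zero] at hk
    rw [← hshift_zero w, EmbeddingLike.apply_eq_iff_eq] at hk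
    exact (Fin.partialProd u l).1.injective (hk.symm.trans (hself l).symm)
  rw [Perm.viaEmbeddingHom_injective _ (mul_right_cancel hxy)]

theorem IsCoxeterTypeA.exists_monoidHom {t : Fin n → M} (ht : IsCoxeterTypeA t) :
    ∃ f : Perm (Fin (n + 1)) →* M, ∀ i : Fin n, f (swap i.castSucc i.succ) = t i := by
  induction n with
  | zero => exact ⟨1, fun i => i.elim0⟩
  | succ n ih =>
    obtain ⟨f, hf⟩ := ih ht.comp_succ
    exact exists_monoidHom_of_injOn_fst (Perm.mclosure_swap_castSucc_succ _) (ht.injOn_fst hf)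

end Coxeter

section Antisymmetrizer

variable {A : Type*} [Ring A]

/-- The antisymmetrizer of the symmetric group on three letters, `x` and `y` being the images in
the ring `A` of two transpositions with one common letter. -/
def antisymmetrizer (x y : A) : A :=
  1 - x - y + x * y + y * x - x * y * x

theorem antisymmetrizer_one_sub (a b : A) :
    antisymmetrizer (1 - a) (1 - b) = a * b * a - a * a + a := by
  unfold antisymmetrizer
  noncomm_ring

theorem antisymmetrizer_sub_antisymmetrizer (x y : A) :
    antisymmetrizer x y - antisymmetrizer y x = y * x * y - x * y * x := by
  unfold antisymmetrizer
  abel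

theorem antisymmetrizer_map_conj {G : Type*} [Group G] (ρ : G →* A) (g x y : G) :
    antisymmetrizer (ρ (g * x * g⁻¹)) (ρ (g * y * g⁻¹)) =
      ρ g * antisymmetrizer (ρ x) (ρ y) * ρ g⁻¹ := by
  simp only [antisymmetrizer, mul_add, mul_sub, add_mul, sub_mul, mul_one, ← map_mul, mul_assoc,
    inv_mul_cancel_left, mul_inv_cancel, map_one]

theorem antisymmetrizer_apply_eq_zero {R V : Type*} [Ring R] [AddCommGroup V] [Module R V]
    {x y : Module.End R V} (hx : x * x = 1) (hy : y * y = 1) (hbraid : x * y * x = y * x * y)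
    {v : V} (hv : x v = v ∨ y v = v ∨ x (y (x v)) = v) : antisymmetrizer x y v = 0 := by
  have hxx u : x (x u) = u := DFunLike.congr_fun hx u
  have hyy u : y (y u) = u := DFunLike.congr_fun hy u
  have hyxy : x (y (x v)) = y (x (y v)) := DFunLike.congr_fun hbraid v
  simp only [antisymmetrizer, LinearMap.sub_apply, LinearMap.add_apply, Module.End.mul_apply,
    Module.End.one_apply]
  obtain hv | hv | hv := hv
  · rw [hv]
    abel
  · rw [hyxy, hv]
    abel
  · have hyx : y (x v) = x v := by rw [← hxx (y (x v)), hv]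
    have hxy : x (y v) = y v := by rw [← hyy (x (y v)), ← hyxy, hv]
    rw [hv, hyx, hxy]
    abel

/-- A homomorphism of permutations satisfies this if its linear extension kills the antisymmetrizers
of all triples of letters, which generate the kernel of the map to the Temperley-Lieb algebra. -/
def KillsAntisymmetrizers {α : Type*} [DecidableEq α] (ρ : Perm α →* A) : Prop :=
  ∀ ⦃a b c : α⦄, a ≠ b → a ≠ c → b ≠ c → antisymmetrizer (ρ (swap a b)) (ρ (swap b c)) = 0

end Antisymmetrizer

section Presentation

variable {n : ℕ}

theorem isCoxeterTypeA_s (n : ℕ) : IsCoxeterTypeA (s (n := n)) := by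
  cases n with
  | zero => exact ⟨fun i => i.elim0, fun {i} => i.elim0, fun {i} => i.elim0⟩
  | succ n => exact isCoxeterTypeA_swap n

theorem mclosure_range_s (n : ℕ) : Submonoid.closure (Set.range (s (n := n))) = ⊤ := by
  cases n with
  | zero => exact Subsingleton.elim _ _
  | succ n => exact Perm.mclosure_swap_castSucc_succ n

theorem exists_monoidHom_s {M : Type*} [Monoid M] {t : Fin (n - 1) → M} (ht : IsCoxeterTypeA t) :
    ∃ f : Perm (Fin n) →* M, ∀ i, f (s i) = t i := by
  cases n with
  | zero => exact ⟨1, fun i => i.elim0⟩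
  | succ n => exact ht.exists_monoidHom

theorem exists_s_eq_swap {i j : Fin (n - 1)} (h : (i : ℕ) + 1 = j ∨ (j : ℕ) + 1 = i) :
    ∃ a b c : Fin n, a ≠ b ∧ a ≠ c ∧ b ≠ c ∧ s i = swap a b ∧ s j = swap b c := by
  obtain ⟨i, hi⟩ := i
  obtain ⟨j, hj⟩ := j
  obtain rfl | rfl : i + 1 = j ∨ j + 1 = i := h
  · exact ⟨⟨i, by omega⟩, ⟨i + 1, by omega⟩, ⟨i + 2, by omega⟩, by simp, by simp, by simp, rfl, rfl⟩
  · exact ⟨⟨j + 2, by omega⟩, ⟨j + 1, by omega⟩, ⟨j, by omega⟩, by simp, by simp, by simp,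
      swap_comm _ _, swap_comm _ _⟩

theorem e_mul_self (i : Fin (n - 1)) : e i * e i = (2 : ℂ) • e i := by
  simpa only [e, map_mul, map_smul] using RingQuot.mkAlgHom_rel ℂ (Rel.sq i)

theorem e_mul_comm {i j : Fin (n - 1)} (h : (i : ℕ) + 1 < j ∨ (j : ℕ) + 1 < i) :
    e i * e j = e j * e i := by
  simpa only [e, map_mul] using RingQuot.mkAlgHom_rel ℂ (Rel.comm i j h)

theorem e_braid {i j : Fin (n - 1)} (h : (i : ℕ) + 1 = j ∨ (j : ℕ) + 1 = i) :
    e i * e j * e i = e i := by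
  simpa only [e, map_mul] using RingQuot.mkAlgHom_rel ℂ (Rel.braid i j h)

theorem adjoin_range_e (n : ℕ) : Algebra.adjoin ℂ (Set.range (e (n := n))) = ⊤ := by
  have h := congrArg (Subalgebra.map (RingQuot.mkAlgHom ℂ (Rel n)))
    (FreeAlgebra.adjoin_range_ι (R := ℂ) (X := Fin (n - 1)))
  rwa [AlgHom.map_adjoin, Algebra.map_top,
    (AlgHom.range_eq_top _).2 (RingQuot.mkAlgHom_surjective ℂ _), ← Set.range_comp] at h

theorem antisymmetrizer_one_sub_e {i j : Fin (n - 1)}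
    (h : (i : ℕ) + 1 = j ∨ (j : ℕ) + 1 = i) : antisymmetrizer (1 - e i) (1 - e j) = 0 := by
  rw [antisymmetrizer_one_sub, e_braid h, e_mul_self, two_smul]
  abel

theorem isCoxeterTypeA_one_sub_e (n : ℕ) : IsCoxeterTypeA fun i : Fin (n - 1) => 1 - e i where
  mul_self i := by
    rw [mul_sub, mul_one, sub_mul, one_mul, e_mul_self, two_smul]
    abel
  comm h := by
    simp only [mul_sub, sub_mul, e_mul_comm (.inl h), one_mul, mul_one]
    abel
  braid {i j} h := by
    have hsub := antisymmetrizer_sub_antisymmetrizer (1 - e i) (1 - e j)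
    rw [antisymmetrizer_one_sub_e (.inl h), antisymmetrizer_one_sub_e (.inr h), sub_zero] at hsub
    exact (sub_eq_zero.1 hsub.symm).symm

/-- The homomorphism from `S_n` to the Temperley-Lieb algebra with `s_i ↦ 1 - e_i`. -/
noncomputable def permToTL (n : ℕ) : Perm (Fin n) →* TL n :=
  (exists_monoidHom_s (isCoxeterTypeA_one_sub_e n)).choose

theorem permToTL_s (i : Fin (n - 1)) : permToTL n (s i) = 1 - e i :=
  (exists_monoidHom_s (isCoxeterTypeA_one_sub_e n)).choose_spec i

/-- The linear extension `ℂ[S_n] → TL_n(2)` of `permToTL`. -/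
noncomputable def fromPerm (n : ℕ) : MonoidAlgebra ℂ (Perm (Fin n)) →ₐ[ℂ] TL n :=
  MonoidAlgebra.lift ℂ _ _ (permToTL n)

theorem fromPerm_of (w : Perm (Fin n)) : fromPerm n (MonoidAlgebra.of ℂ _ w) = permToTL n w :=
  MonoidAlgebra.lift_of _ _

theorem fromPerm_s (i : Fin (n - 1)) : fromPerm n (MonoidAlgebra.of ℂ _ (s i)) = 1 - e i := by
  rw [fromPerm_of, permToTL_s]

theorem algHom_ext_s {A : Type*} [Semiring A] [Algebra ℂ A]
    {f g : MonoidAlgebra ℂ (Perm (Fin n)) →ₐ[ℂ] A}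
    (h : ∀ i : Fin (n - 1), f (MonoidAlgebra.of ℂ _ (s i)) = g (MonoidAlgebra.of ℂ _ (s i))) :
    f = g := by
  refine (MonoidAlgebra.lift ℂ A (Perm (Fin n))).symm.injective
    (MonoidHom.eq_of_eqOn_denseM (mclosure_range_s n) ?_)
  rintro _ ⟨i, rfl⟩
  exact h i

theorem fromPerm_surjective (n : ℕ) : Function.Surjective (fromPerm n) := by
  rw [← AlgHom.range_eq_top, ← top_le_iff, ← adjoin_range_e, Algebra.adjoin_le_iff]
  rintro _ ⟨i, rfl⟩
  refine ⟨1 - MonoidAlgebra.of ℂ _ (s i), ?_⟩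
  exact (map_sub (fromPerm n) _ _).trans (by rw [map_one, fromPerm_s, sub_sub_cancel])

instance : Module.Finite ℂ (TL n) :=
  .of_surjective (fromPerm n).toLinearMap (fromPerm_surjective n)

theorem killsAntisymmetrizers_permToTL (n : ℕ) : KillsAntisymmetrizers (permToTL n) := by
  intro a b c hab hac hbc
  have hinj {x y z : Fin n} (hxy : x ≠ y) (hxz : x ≠ z) (hyz : y ≠ z) :
      Function.Injective ![x, y, z] := by
    simp [Function.Injective, Fin.forall_fin_succ, hxy, hxz, hyz, hxy.symm, hxz.symm, hyz.symm]
  have hn : 3 ≤ n := by simpa using Fintype.card_le_of_injective _ (hinj hab hac hbc)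
  obtain ⟨x, y, z, hxy, hxz, hyz, hi, hj⟩ :=
    exists_s_eq_swap (n := n) (i := ⟨0, by omega⟩) (j := ⟨1, by omega⟩) (.inl rfl)
  obtain ⟨σ, hσ⟩ := Perm.exists_extending_pair _ _ (hinj hxy hxz hyz) (hinj hab hac hbc)
  obtain ⟨rfl, rfl, rfl⟩ : σ x = a ∧ σ y = b ∧ σ z = c := ⟨hσ 0, hσ 1, hσ 2⟩
  rw [swap_apply_apply, swap_apply_apply, antisymmetrizer_map_conj, ← hi, ← hj, permToTL_s,
    permToTL_s, antisymmetrizer_one_sub_e (.inl rfl), mul_zero, zero_mul]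

section Lift

variable {A : Type*} [Ring A] [Algebra ℂ A] {ρ : Perm (Fin n) →* A}

theorem KillsAntisymmetrizers.lift_eq_of_rel (hρ : KillsAntisymmetrizers ρ)
    {x y : FreeAlgebra ℂ (Fin (n - 1))} (h : Rel n x y) :
    FreeAlgebra.lift ℂ (fun i => 1 - ρ (s i)) x = FreeAlgebra.lift ℂ (fun i => 1 - ρ (s i)) y := by
  have hsq i : (1 - ρ (s i)) * (1 - ρ (s i)) = (1 - ρ (s i)) + (1 - ρ (s i)) := by
    rw [mul_sub, mul_one, sub_mul, one_mul, ← map_mul, (isCoxeterTypeA_s n).mul_self, map_one]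
    abel
  have hcomm {i j : Fin (n - 1)} (h : (i : ℕ) + 1 < j) :
      (1 - ρ (s i)) * (1 - ρ (s j)) = (1 - ρ (s j)) * (1 - ρ (s i)) := by
    simp only [mul_sub, sub_mul, ← map_mul, (isCoxeterTypeA_s n).comm h, one_mul, mul_one]
    abel
  cases h with
  | sq i => rw [map_mul, map_smul, FreeAlgebra.lift_ι_apply, hsq, two_smul]
  | comm i j h =>
    simp only [map_mul, FreeAlgebra.lift_ι_apply]
    exact h.elim hcomm fun h => (hcomm h).symm
  | braid i j h =>
    obtain ⟨a, b, c, hab, hac, hbc, hi, hj⟩ := exists_s_eq_swap h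
    have hzero := antisymmetrizer_one_sub (1 - ρ (s i)) (1 - ρ (s j))
    rw [sub_sub_cancel, sub_sub_cancel, hsq, sub_add, add_sub_cancel_right, hi, hj,
      hρ hab hac hbc] at hzero
    rw [map_mul, map_mul, FreeAlgebra.lift_ι_apply, FreeAlgebra.lift_ι_apply, hi, hj]
    exact sub_eq_zero.1 hzero.symm

theorem KillsAntisymmetrizers.exists_algHom (hρ : KillsAntisymmetrizers ρ) :
    ∃ f : TL n →ₐ[ℂ] A, ∀ w, f (permToTL n w) = ρ w := by
  let f : TL n →ₐ[ℂ] A := RingQuot.liftAlgHom ℂ ⟨_, fun _ _ h => hρ.lift_eq_of_rel h⟩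
  have hf i : f (e i) = 1 - ρ (s i) := by
    rw [e, RingQuot.liftAlgHom_mkAlgHom_apply, FreeAlgebra.lift_ι_apply]
  refine ⟨f, DFunLike.congr_fun (f := (f : TL n →* A).comp (permToTL n)) ?_⟩
  refine MonoidHom.eq_of_eqOn_denseM (mclosure_range_s n) ?_
  rintro _ ⟨i, rfl⟩
  rw [MonoidHom.comp_apply, permToTL_s, MonoidHom.coe_coe, map_sub, map_one, hf, sub_sub_cancel]

end Lift

end Presentation

section PermutationRepresentation

open scoped Pointwise

theorem swap_smul_finset {α : Type*} [DecidableEq α] {a b : α} {X : Finset α}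
    (h : a ∈ X ↔ b ∈ X) : swap a b • X = X := by
  ext x
  rw [← Finset.inv_smul_mem_iff, swap_inv, Perm.smul_def]
  obtain rfl | hxa := eq_or_ne x a
  · rw [swap_apply_left, h]
  obtain rfl | hxb := eq_or_ne x b
  · rw [swap_apply_right, h]
  · rw [swap_apply_of_ne_of_ne hxa hxb]

/-- A set of letters contains both or neither of two of any three letters, and is then fixed by
their transposition. -/
theorem killsAntisymmetrizers_ofMulAction_finset (R α : Type*) [CommRing R] [DecidableEq α] :
    KillsAntisymmetrizers (Representation.ofMulAction R (Perm α) (Finset α)) := by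
  intro a b c hab hac hbc
  set ρ := Representation.ofMulAction R (Perm α) (Finset α)
  have hsq (u v : α) : ρ (swap u v) * ρ (swap u v) = 1 := by
    rw [← map_mul, swap_mul_self, map_one]
  have hbraid : ρ (swap a b) * ρ (swap b c) * ρ (swap a b) =
      ρ (swap b c) * ρ (swap a b) * ρ (swap b c) := by
    simp only [← map_mul, swap_braid hab hac hbc]
  refine MonoidAlgebra.lhom_ext' fun X => LinearMap.ext_ring ?_
  have hfix {u v : α} (h : u ∈ X ↔ v ∈ X) :
      ρ (swap u v) (MonoidAlgebra.single X 1) = MonoidAlgebra.single X 1 := by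
    rw [Representation.ofMulAction_single, swap_smul_finset h]
  refine antisymmetrizer_apply_eq_zero (hsq a b) (hsq b c) hbraid ?_
  obtain h | h | h : (a ∈ X ↔ b ∈ X) ∨ (b ∈ X ↔ c ∈ X) ∨ (c ∈ X ↔ a ∈ X) := by tauto
  · exact .inl (hfix h)
  · exact .inr (.inl (hfix h))
  · refine .inr (.inr ?_)
    rw [← Module.End.mul_apply, ← Module.End.mul_apply, hbraid, ← map_mul, ← map_mul,
      swap_mul_swap_mul_swap hab hac]
    exact hfix h

theorem linearIndependent_of_triangular {R V ι : Type*} [Ring R] [AddCommGroup V] [Module R V]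
    [PartialOrder ι] {v : ι → V} (φ : ι → V →ₗ[R] R) (hdiag : ∀ i, φ i (v i) = 1)
    (htri : ∀ i j, φ j (v i) ≠ 0 → j ≤ i) : LinearIndependent R v := by
  rw [linearIndependent_iff]
  intro c hc
  by_contra hne
  obtain ⟨j, hj⟩ := c.support.exists_maximal (Finsupp.support_nonempty_iff.2 hne)
  refine Finsupp.mem_support_iff.1 hj.prop ?_
  have hsum := congrArg (φ j) hc
  rw [Finsupp.linearCombination_apply, Finsupp.sum, map_sum, Finset.sum_eq_single_of_mem j hj.prop,
    map_smul, hdiag, smul_eq_mul, mul_one, map_zero] at hsum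
  · exact hsum
  · intro i hi hij
    rw [map_smul, not_not.1 (mt (htri i j) fun hji => hij (hj.eq_of_ge hi hji)), smul_zero]

theorem linearIndependent_ofMulAction {R G H ι : Type*} [CommRing R] [Monoid G] [MulAction G H]
    [PartialOrder ι] {g : ι → G} {x y : ι → H} (hdiag : ∀ i, g i • x i = y i)
    (htri : ∀ i j, g i • x j = y j → j ≤ i) :
    LinearIndependent R fun i => Representation.ofMulAction R G H (g i) := by
  classical
  have hentry (i j : ι) : (Representation.ofMulAction R G H (g i)
      (MonoidAlgebra.single (x j) 1)).coeff (y j) = if g i • x j = y j then 1 else 0 := by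
    rw [Representation.ofMulAction_single, MonoidAlgebra.coeff_single, Finsupp.single_apply]
  let entry (j : ι) : Module.End R (MonoidAlgebra R H) →ₗ[R] R :=
    Finsupp.lapply (y j) ∘ₗ (MonoidAlgebra.coeffLinearEquiv R).toLinearMap ∘ₗ
      LinearMap.applyₗ (MonoidAlgebra.single (x j) (1 : R))
  refine linearIndependent_of_triangular entry (fun i => ?_) fun i j h => ?_
  · exact (hentry i i).trans (if_pos (hdiag i))
  · exact htri i j (by_contra fun hij => h ((hentry i j).trans (if_neg hij)))

end PermutationRepresentation

section NoncrossingPartition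

variable {n : ℕ}

namespace NCP

variable {p q : NCP n}

theorem arcs_injective : Function.Injective (arcs (n := n)) := by
  rintro ⟨⟩ ⟨⟩ rfl
  rfl

noncomputable instance : Fintype (NCP n) :=
  .ofInjective arcs arcs_injective

theorem mem_left {i : Fin n} : i ∈ p.left ↔ ∃ j, (i, j) ∈ p.arcs := by
  simp [left]

theorem mem_right {j : Fin n} : j ∈ p.right ↔ ∃ i, (i, j) ∈ p.arcs := by
  simp [right]

theorem injOn_fst (p : NCP n) : Set.InjOn Prod.fst (p.arcs : Set (Fin n × Fin n)) := by
  intro x hx y hy hxy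
  by_contra hne
  have hlt := p.lt_of_mem x hx
  have hlt' := p.lt_of_mem y hy
  have hxy' := p.noncrossing x hx y hy hne
  have hyx := p.noncrossing y hy x hx (Ne.symm hne)
  omega

theorem injOn_snd (p : NCP n) : Set.InjOn Prod.snd (p.arcs : Set (Fin n × Fin n)) := by
  intro x hx y hy hxy
  by_contra hne
  have hlt := p.lt_of_mem x hx
  have hlt' := p.lt_of_mem y hy
  have hxy' := p.noncrossing x hx y hy hne
  have hyx := p.noncrossing y hy x hx (Ne.symm hne)
  omega

/-- The arc ending at `j` starts at the nearest left endpoint not matched before `j`. -/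
theorem fst_le_of_mem_of_mem (hl : q.left ⊆ p.left) {i i' j : Fin n}
    (hlt : ∀ a, ∀ b < j, (a, b) ∈ p.arcs → (a, b) ∈ q.arcs)
    (hi : (i, j) ∈ p.arcs) (hi' : (i', j) ∈ q.arcs) : i' ≤ i := by
  by_contra! hii'
  obtain ⟨b, hb⟩ := mem_left.1 (hl (mem_left.2 ⟨j, hi'⟩))
  have hbj : b < j := by
    by_contra! hjb
    exact p.noncrossing _ hi _ hb (fun h => hii'.ne (congrArg Prod.fst h))
      ⟨hii'.le, q.lt_of_mem _ hi', hjb⟩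
  exact hbj.ne (congrArg Prod.snd (q.injOn_fst (hlt _ _ hbj hb) hi' rfl))

theorem mem_arcs_of_forall_lt (hl : p.left = q.left) (hr : p.right = q.right) {i j : Fin n}
    (hlt : ∀ a, ∀ b < j, (a, b) ∈ p.arcs ↔ (a, b) ∈ q.arcs) (hi : (i, j) ∈ p.arcs) :
    (i, j) ∈ q.arcs := by
  obtain ⟨i', hi'⟩ := mem_right.1 (hr ▸ mem_right.2 ⟨i, hi⟩)
  obtain rfl : i = i' := le_antisymm
    (fst_le_of_mem_of_mem hl.le (fun a b h => (hlt a b h).2) hi' hi)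
    (fst_le_of_mem_of_mem hl.ge (fun a b h => (hlt a b h).1) hi hi')
  exact hi'

theorem ext_left_right (hl : p.left = q.left) (hr : p.right = q.right) : p = q := by
  suffices h : ∀ j i, (i, j) ∈ p.arcs ↔ (i, j) ∈ q.arcs from
    arcs_injective (Finset.ext fun x => h x.2 x.1)
  intro j
  induction j using WellFoundedLT.induction with
  | ind j ih =>
    exact fun i => ⟨mem_arcs_of_forall_lt hl hr fun a b hb => ih b hb a,
      mem_arcs_of_forall_lt hl.symm hr.symm fun a b hb => (ih b hb a).symm⟩

/-- The number of arcs strictly above the point `m` when the letter `k` is drawn at `2k + 1`. -/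
def depth (p : NCP n) (m : ℕ) : ℕ :=
  {x ∈ p.arcs | 2 * (x.1 : ℕ) + 1 < m ∧ m < 2 * (x.2 : ℕ) + 1}.card

theorem mem_left_iff_depth_lt {k : Fin n} :
    k ∈ p.left ↔ p.depth (2 * k + 1) < p.depth (2 * k + 2) := by
  rw [mem_left]
  constructor
  · rintro ⟨j, hj⟩
    have hlt : k < j := p.lt_of_mem _ hj
    refine Finset.card_lt_card (Finset.ssubset_iff_of_subset ?_ |>.2 ⟨(k, j), ?_, ?_⟩)
    · exact Finset.monotone_filter_right _ fun x _ => by omega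
    · exact Finset.mem_filter.2 ⟨hj, by simp only; omega⟩
    · simp
  · contrapose!
    intro hk
    refine Finset.card_le_card fun x hx => ?_
    rw [Finset.mem_filter] at hx ⊢
    have hne : x.1 ≠ k := fun h => hk x.2 (h ▸ hx.1)
    exact ⟨hx.1, by omega⟩

theorem mem_right_iff_depth_lt {k : Fin n} :
    k ∈ p.right ↔ p.depth (2 * k + 1) < p.depth (2 * k) := by
  rw [mem_right]
  constructor
  · rintro ⟨i, hi⟩
    have hlt : i < k := p.lt_of_mem _ hi
    refine Finset.card_lt_card (Finset.ssubset_iff_of_subset ?_ |>.2 ⟨(i, k), ?_, ?_⟩)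
    · exact Finset.monotone_filter_right _ fun x _ => by omega
    · exact Finset.mem_filter.2 ⟨hi, by simp only; omega⟩
    · simp
  · contrapose!
    intro hk
    refine Finset.card_le_card fun x hx => ?_
    rw [Finset.mem_filter] at hx ⊢
    have hne : x.2 ≠ k := fun h => hk x.1 (h ▸ hx.1)
    exact ⟨hx.1, by omega⟩

theorem depth_injective : Function.Injective (depth (n := n)) := fun p q h =>
  ext_left_right (Finset.ext fun k => by rw [mem_left_iff_depth_lt, mem_left_iff_depth_lt, h])
    (Finset.ext fun k => by rw [mem_right_iff_depth_lt, mem_right_iff_depth_lt, h])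

/-- `p ≤ q` if above every point there are at most as many arcs of `p` as of `q`. -/
instance : PartialOrder (NCP n) :=
  .lift depth depth_injective

theorem card_left_eq_card_right_add_depth (p : NCP n) (m : ℕ) :
    (p.left.filter fun i : Fin n => 2 * (i : ℕ) + 1 < m).card =
      (p.right.filter fun j : Fin n => 2 * (j : ℕ) + 1 ≤ m).card + p.depth m := by
  rw [left, right, depth, Finset.filter_image, Finset.filter_image,
    Finset.card_image_of_injOn (p.injOn_fst.mono (Finset.coe_subset.2 (Finset.filter_subset _ _))),
    Finset.card_image_of_injOn (p.injOn_snd.mono (Finset.coe_subset.2 (Finset.filter_subset _ _))),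
    ← Finset.card_union_of_disjoint]
  · congr 1
    ext x
    simp only [Finset.mem_union, Finset.mem_filter]
    have := p.lt_of_mem x
    grind
  · exact Finset.disjoint_filter.2 fun x _ h => by omega

end NCP

end NoncrossingPartition

section Independence

variable {n : ℕ}

theorem mem_excPos {w : Perm (Fin n)} {i : Fin n} : i ∈ excPos w ↔ i ≤ w i := by
  simp [excPos]

theorem card_filter_add_card_filter_not_and {α : Type*} (X : Finset α) (P Q : α → Prop)
    [DecidablePred P] [DecidablePred Q] :
    (X.filter P).card + (X.filter fun x => ¬P x ∧ Q x).card =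
      (X.filter Q).card + (X.filter fun x => P x ∧ ¬Q x).card := by
  simp only [Finset.card_filter, ← Finset.sum_add_distrib]
  refine Finset.sum_congr rfl fun x _ => ?_
  by_cases hP : P x <;> by_cases hQ : Q x <;> simp [hP, hQ]

theorem NCP.depth_add_card_eq {q : NCP n} {w : Perm (Fin n)} (hw : q.rightᶜ.image w = q.leftᶜ)
    (m : ℕ) :
    q.depth m + (Finset.univ.filter fun k : Fin n => 2 * (k : ℕ) + 1 ≤ m).card +
        (q.rightᶜ.filter fun x : Fin n => ¬2 * (x : ℕ) + 1 ≤ m ∧ 2 * (w x : ℕ) + 1 < m).card =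
      (Finset.univ.filter fun k : Fin n => 2 * (k : ℕ) + 1 < m).card +
        (q.rightᶜ.filter fun x : Fin n => 2 * (x : ℕ) + 1 ≤ m ∧ ¬2 * (w x : ℕ) + 1 < m).card := by
  have hsplit (X : Finset (Fin n)) (P : Fin n → Prop) [DecidablePred P] :
      (Finset.univ.filter P).card = (X.filter P).card + (Xᶜ.filter P).card := by
    rw [← Finset.card_union_of_disjoint (Finset.disjoint_filter_filter disjoint_compl_right),
      ← Finset.filter_union, Finset.union_compl]
  have himage : (q.leftᶜ.filter fun k : Fin n => 2 * (k : ℕ) + 1 < m).card =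
      (q.rightᶜ.filter fun x : Fin n => 2 * (w x : ℕ) + 1 < m).card := by
    rw [← hw, Finset.filter_image, Finset.card_image_of_injective _ w.injective]
  have hcount := q.card_left_eq_card_right_add_depth m
  have hexchange := card_filter_add_card_filter_not_and q.rightᶜ
    (fun x => 2 * (x : ℕ) + 1 ≤ m) (fun x => 2 * (w x : ℕ) + 1 < m)
  rw [hsplit q.right, hsplit q.left, himage]
  omega

theorem NCP.le_of_mem_excClass {p q : NCP n} {w : Perm (Fin n)} (hw : w ∈ excClass p)
    (hq : q.rightᶜ.image w = q.leftᶜ) : q ≤ p := by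
  intro m
  obtain ⟨hval, hpos⟩ := hw
  have hp : p.rightᶜ.image w = p.leftᶜ := by rw [← hpos, ← hval, excVal]
  have hcount_p := depth_add_card_eq hp m
  have hcount_q := depth_add_card_eq hq m
  have hdesc : p.rightᶜ.filter
      (fun x : Fin n => ¬2 * (x : ℕ) + 1 ≤ m ∧ 2 * (w x : ℕ) + 1 < m) = ∅ := by
    refine Finset.filter_eq_empty_iff.2 fun x hx => ?_
    rw [← hpos, mem_excPos] at hx
    omega
  have hasc : (q.rightᶜ.filter fun x : Fin n => 2 * (x : ℕ) + 1 ≤ m ∧ ¬2 * (w x : ℕ) + 1 < m).card ≤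
      (p.rightᶜ.filter fun x : Fin n => 2 * (x : ℕ) + 1 ≤ m ∧ ¬2 * (w x : ℕ) + 1 < m).card := by
    refine Finset.card_le_card fun x hx => ?_
    rw [Finset.mem_filter] at hx ⊢
    refine ⟨?_, hx.2⟩
    rw [← hpos, mem_excPos]
    omega
  rw [hdesc, Finset.card_empty] at hcount_p
  change q.depth m ≤ p.depth m
  omega

open scoped Pointwise in
theorem linearIndependent_permToTL {w : NCP n → Perm (Fin n)} (hw : ∀ p, w p ∈ excClass p) :
    LinearIndependent ℂ fun p => permToTL n (w p) := by
  obtain ⟨f, hf⟩ := (killsAntisymmetrizers_ofMulAction_finset ℂ (Fin n)).exists_algHom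
  refine LinearIndependent.of_comp f.toLinearMap ?_
  have hdiag p : w p • p.rightᶜ = p.leftᶜ := by
    rw [← (hw p).1, ← (hw p).2]
    rfl
  rw [show f.toLinearMap ∘ (fun p => permToTL n (w p)) = _ from funext fun p => hf (w p)]
  exact linearIndependent_ofMulAction hdiag fun p q h => NCP.le_of_mem_excClass (hw p) h

end Independence

section ExcedanceClass

theorem toLex_mul_swap_lt {α : Type*} [LinearOrder α] {w : Perm α} {a b : α} (hab : a < b)
    (h : w b < w a) : toLex ⇑(w * swap a b) < toLex ⇑w :=
  Pi.lex_desc hab.le h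

variable {n : ℕ} {w : Perm (Fin n)} {k l : Fin n}

theorem excPos_mul_swap (hkl : k < l) (hk : w k < k) (hl : w l < k) :
    excPos (w * swap k l) = excPos w := by
  ext x
  rw [mem_excPos, mem_excPos, Perm.mul_apply]
  obtain rfl | hxk := eq_or_ne x k
  · rw [swap_apply_left]
    exact iff_of_false hl.not_ge hk.not_ge
  obtain rfl | hxl := eq_or_ne x l
  · rw [swap_apply_right]
    exact iff_of_false (hk.trans hkl).not_ge (hl.trans hkl).not_ge
  · rw [swap_apply_of_ne_of_ne hxk hxl]

theorem excVal_mul_swap (hkl : k < l) (hk : w k < k) (hl : w l < k) :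
    excVal (w * swap k l) = excVal w := by
  rw [excVal, excVal, excPos_mul_swap hkl hk hl]
  refine Finset.image_congr fun x hx => ?_
  rw [Finset.mem_coe, mem_excPos] at hx
  rw [Perm.mul_apply, swap_apply_of_ne_of_ne]
  · rintro rfl
    exact hk.not_ge hx
  · rintro rfl
    exact (hl.trans hkl).not_ge hx

theorem image_compl_excPos (w : Perm (Fin n)) : (excPos w)ᶜ.image w = (excVal w)ᶜ := by
  rw [← Finset.coe_inj, Finset.coe_image, Finset.coe_compl, Set.image_compl_eq w.bijective,
    Finset.coe_compl, excVal, Finset.coe_image]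

theorem exists_excPos_eq_excVal_eq_forall_lt (w : Perm (Fin n)) :
    ∃ v, excPos v = excPos w ∧ excVal v = excVal w ∧
      ∀ k l, k < l → v k < v l → k ≤ v l := by
  obtain ⟨v, ⟨hpos, hval⟩, hmax⟩ := Set.exists_max_image
    {v | excPos v = excPos w ∧ excVal v = excVal w} (fun v => toLex ⇑v) (Set.toFinite _)
    ⟨w, rfl, rfl⟩
  refine ⟨v, hpos, hval, fun k l hkl hlt => ?_⟩
  by_contra! hl
  have hk : v k < k := hlt.trans hl
  have hmem := And.intro ((excPos_mul_swap hkl hk hl).trans hpos)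
    ((excVal_mul_swap hkl hk hl).trans hval)
  have hlex := toLex_mul_swap_lt (w := v * swap k l) hkl (by simpa using hlt)
  rw [mul_assoc, swap_mul_self, mul_one] at hlex
  exact (hmax _ hmem).not_gt hlex

/-- The arcs join the deficient positions of the lexicographically largest permutation with the
excedance sets of `w` to their values. -/
theorem exists_mem_excClass (w : Perm (Fin n)) : ∃ p : NCP n, w ∈ excClass p := by
  obtain ⟨v, hpos, hval, hv⟩ := exists_excPos_eq_excVal_eq_forall_lt w
  let p : NCP n :=
    { arcs := (excPos v)ᶜ.image fun k => (v k, k)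
      lt_of_mem := by simp [mem_excPos]
      noncrossing := by
        simp only [Finset.forall_mem_image]
        rintro k - l - hne ⟨hkl, hlt, hle⟩
        have hne' : k ≠ l := fun h => hne (by rw [h])
        exact (hv k l (hle.lt_of_ne hne') (hkl.lt_of_ne (v.injective.ne hne'))).not_gt hlt }
  have hright : p.right = (excPos v)ᶜ := by
    simp only [NCP.right, p, Finset.image_image, Function.comp_def, Finset.image_id']
  have hleft : p.left = (excVal v)ᶜ := by
    rw [NCP.left, Finset.image_image, ← image_compl_excPos]
    rfl
  exact ⟨p, by rw [hleft, compl_compl, hval], by rw [hright, compl_compl, hpos]⟩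

end ExcedanceClass

section Avoids321

/-- A permutation is `321`-avoiding if it has no decreasing subsequence of length three. -/
def Avoids321 {α : Type*} [LinearOrder α] (w : Perm α) : Prop :=
  ∀ ⦃i j k⦄, i < j → j < k → w j < w i → ¬ w k < w j

theorem map_mul_eq_of_antisymmetrizer_eq_zero {A G : Type*} [Ring A] [Group G] {ρ : G →* A}
    {x y : G} (h : antisymmetrizer (ρ x) (ρ y) = 0) (w : G) :
    ρ w = ρ (w * x) + ρ (w * y) - ρ (w * x * y) - ρ (w * y * x) + ρ (w * x * y * x) := by
  have hw : ρ w * antisymmetrizer (ρ x) (ρ y) = 0 := by rw [h, mul_zero]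
  rw [← sub_eq_zero, ← hw, antisymmetrizer]
  simp only [map_mul]
  noncomm_ring

/-- The antisymmetrizer of the letters of a `321` pattern rewrites the permutation in terms of
lexicographically smaller ones. -/
theorem mem_span_avoids321 {R A α : Type*} [CommRing R] [Ring A] [Algebra R A] [LinearOrder α]
    [Finite α] {ρ : Perm α →* A} (hρ : KillsAntisymmetrizers ρ) (w : Perm α) :
    ρ w ∈ Submodule.span R (ρ '' {v | Avoids321 v}) := by
  induction w using (InvImage.wf (fun w : Perm α => toLex ⇑w) wellFounded_lt).induction with
  | _ w ih =>
    by_cases hw : Avoids321 w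
    · exact Submodule.subset_span ⟨w, hw, rfl⟩
    simp only [Avoids321, not_forall, not_not] at hw
    obtain ⟨a, b, c, hab, hbc, hba, hcb⟩ := hw
    have hac := hab.trans hbc
    have hca := hcb.trans hba
    have hx := toLex_mul_swap_lt hab hba
    have hy := toLex_mul_swap_lt hbc hcb
    have hxy := toLex_mul_swap_lt (w := w * swap a b) hbc
      (by simpa [swap_apply_of_ne_of_ne hac.ne' hbc.ne'])
    have hyx := toLex_mul_swap_lt (w := w * swap b c) hab
      (by simpa [swap_apply_of_ne_of_ne hab.ne hac.ne])
    have hxyx := toLex_mul_swap_lt (w := w * swap a b * swap b c) hab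
      (by simpa [swap_apply_of_ne_of_ne hac.ne' hbc.ne', swap_apply_of_ne_of_ne hab.ne hac.ne])
    rw [map_mul_eq_of_antisymmetrizer_eq_zero (hρ hab.ne hac.ne hbc.ne) w]
    exact add_mem (sub_mem (sub_mem (add_mem (ih _ hx) (ih _ hy)) (ih _ (hxy.trans hx)))
      (ih _ (hyx.trans hy))) (ih _ (hxyx.trans (hxy.trans hx)))

theorem exists_gt_apply_lt_of_le_apply {α : Type*} [Finite α] [LinearOrder α] {f : α → α}
    (hf : Function.Injective f) {i j : α} (hij : i < j) (hji : f j < f i) (hj : j ≤ f j) :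
    ∃ k > j, f k < f j := by
  by_contra! hle
  have hmaps : Set.MapsTo f (Set.Ioi j) (Set.Ioi j) := fun k hk =>
    hj.trans_lt ((hle k hk).lt_of_ne (hf.ne (ne_of_lt hk)))
  have hbij := ((Set.toFinite _).injOn_iff_bijOn_of_mapsTo hmaps).1 hf.injOn
  obtain ⟨k, hk, hki⟩ := hbij.surjOn (hj.trans_lt hji)
  exact hij.not_gt (hf hki ▸ hk)

theorem exists_lt_apply_lt_of_apply_le {α : Type*} [Finite α] [LinearOrder α] {f : α → α}
    (hf : Function.Injective f) {i j : α} (hij : i < j) (hji : f j < f i) (hi : f i ≤ i) :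
    ∃ k < i, f i < f k :=
  exists_gt_apply_lt_of_le_apply (α := αᵒᵈ) hf hij hji hi

namespace Avoids321

variable {α : Type*} [Finite α] [LinearOrder α] {w : Perm α}

theorem strictMonoOn_of_le_apply (hw : Avoids321 w) : StrictMonoOn w {i | i ≤ w i} := by
  intro i _ j hj hij
  by_contra! hle
  have hji := hle.lt_of_ne (w.injective.ne hij.ne')
  obtain ⟨k, hjk, hkj⟩ := exists_gt_apply_lt_of_le_apply w.injective hij hji hj
  exact hw hij hjk hji hkj

theorem strictMonoOn_of_apply_le (hw : Avoids321 w) : StrictMonoOn w {i | w i ≤ i} := by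
  intro i hi j _ hij
  by_contra! hle
  have hji := hle.lt_of_ne (w.injective.ne hij.ne')
  obtain ⟨k, hki, hik⟩ := exists_lt_apply_lt_of_apply_le w.injective hij hji hi
  exact hw hki hij hik hji

end Avoids321

theorem eqOn_of_strictMonoOn_of_image_eq {α β : Type*} [LinearOrder α] [WellFoundedLT α]
    [PartialOrder β] {f g : α → β} {S : Set α} (hf : StrictMonoOn f S) (hg : StrictMonoOn g S)
    (h : f '' S = g '' S) : Set.EqOn f g S := by
  rw [← Set.domRestrict_eq_domRestrict_iff, ← StrictMono.range_inj hf.domRestrict hg.domRestrict,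
    Set.range_domRestrict, Set.range_domRestrict, h]

theorem Avoids321.eq_of_excPos_eq_of_excVal_eq {n : ℕ} {v w : Perm (Fin n)} (hv : Avoids321 v)
    (hw : Avoids321 w) (hpos : excPos v = excPos w) (hval : excVal v = excVal w) : v = w := by
  have hexc {u : Perm (Fin n)} (hu : Avoids321 u) : StrictMonoOn u (excPos u) :=
    hu.strictMonoOn_of_le_apply.mono fun _ => mem_excPos.1
  have hdef {u : Perm (Fin n)} (hu : Avoids321 u) : StrictMonoOn u (excPos u : Set (Fin n))ᶜ :=
    hu.strictMonoOn_of_apply_le.mono fun _ hi => (not_le.1 (mt mem_excPos.2 hi)).le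
  have himage : v '' excPos w = w '' excPos w := by
    rw [← hpos, ← Finset.coe_image, ← excVal, hval, hpos, excVal, Finset.coe_image]
  ext1 x
  by_cases hx : x ∈ excPos w
  · exact eqOn_of_strictMonoOn_of_image_eq (hpos ▸ hexc hv) (hexc hw) himage hx
  · refine eqOn_of_strictMonoOn_of_image_eq (hpos ▸ hdef hv) (hdef hw) ?_ hx
    rw [Set.image_compl_eq v.bijective, Set.image_compl_eq w.bijective, himage]

end Avoids321

section Dimension

theorem span_permToTL_avoids321 (n : ℕ) :
    Submodule.span ℂ (permToTL n '' {v | Avoids321 v}) = ⊤ := by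
  rw [eq_top_iff]
  rintro x -
  obtain ⟨y, rfl⟩ := fromPerm_surjective n x
  induction y using MonoidAlgebra.induction_on with
  | of w =>
    rw [fromPerm_of]
    exact mem_span_avoids321 (killsAntisymmetrizers_permToTL n) w
  | add a b ha hb =>
    rw [map_add]
    exact add_mem ha hb
  | smul r a ha =>
    rw [map_smul]
    exact Submodule.smul_mem _ r ha

theorem card_avoids321_le (n : ℕ) :
    Nat.card {v : Perm (Fin n) // Avoids321 v} ≤ Nat.card (NCP n) := by
  choose p hp using exists_mem_excClass (n := n)
  refine Nat.card_le_card_of_injective (fun v => p v.1) fun v w hvw => Subtype.ext ?_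
  replace hvw : p v = p w := hvw
  exact v.2.eq_of_excPos_eq_of_excVal_eq w.2
    ((hp v).2.trans (hvw ▸ (hp w).2.symm)) ((hp v).1.trans (hvw ▸ (hp w).1.symm))

theorem finrank_le_card (n : ℕ) : Module.finrank ℂ (TL n) ≤ Fintype.card (NCP n) := by
  classical
  have hspan := span_permToTL_avoids321 n
  rw [Set.image_eq_range] at hspan
  have hle := finrank_le_of_span_eq_top hspan
  rw [← Nat.card_eq_fintype_card] at hle ⊢
  exact hle.trans (card_avoids321_le n)

end Dimension

end TemperleyLieb

theorem mainTheorem3 (n : ℕ) :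
    ∃ φ : MonoidAlgebra ℂ (Equiv.Perm (Fin n)) →ₐ[ℂ] TemperleyLieb.TL n,
      (∀ i : Fin (n - 1),
        φ (MonoidAlgebra.of ℂ _ (TemperleyLieb.s i)) = 1 - TemperleyLieb.e i) ∧
      (∀ ψ : MonoidAlgebra ℂ (Equiv.Perm (Fin n)) →ₐ[ℂ] TemperleyLieb.TL n,
        (∀ i : Fin (n - 1),
          ψ (MonoidAlgebra.of ℂ _ (TemperleyLieb.s i)) = 1 - TemperleyLieb.e i) → ψ = φ) ∧
      Function.Surjective φ ∧
      ∀ w : TemperleyLieb.NCP n → Equiv.Perm (Fin n),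
        (∀ p, w p ∈ TemperleyLieb.excClass p) →
        ∃ b : Module.Basis (TemperleyLieb.NCP n) ℂ (TemperleyLieb.TL n),
          ∀ p, b p = φ (MonoidAlgebra.of ℂ _ (w p)) := by
  open TemperleyLieb in
  refine ⟨fromPerm n, fromPerm_s, fun ψ hψ => algHom_ext_s fun i => ?_, fromPerm_surjective n,
    fun w hw => ?_⟩
  · rw [hψ, fromPerm_s]
  · have hli := linearIndependent_permToTL hw
    have hspan := hli.span_eq_top_of_card_eq_finrank'
      (le_antisymm hli.fintype_card_le_finrank (finrank_le_card n))
    exact ⟨Module.Basis.mk hli hspan.ge, fun p => by rw [Module.Basis.mk_apply, fromPerm_of]⟩
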